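/- Let $k$ be a field. For a finite simple graph $G$ with vertex set $V=\{x_1,\dots,x_n\}$, $n\ge 1$, let $R=k[x_1,\dots,x_n]$, $\mathfrak m=(x_1,\dots,x_n)$, and let $J(G)=\bigcap_{\{x_i,x_j\}\in E(G)}(x_i,x_j)\subseteq R$ be the cover ideal of $G$ (so $J(G)=R$ if $G$ has no edges). A monomial ideal $I$ is called quasi-equigenerated if there are integers $a_1,\dots,a_n\ge 1$ such that all minimal monomial generators of $I$ have the same degree when $x_i$ is given degree $a_i$. Write $\mu(I)$ for the minimal number of generators of $I$, $F(I)=\bigoplus_{i\ge 0} I^i/\mathfrak m I^i$ for its fiber cone, and $l(I)=\dim F(I)$ (Krull dimension) for its analytic spread. The ideal $I$ is called of linear type if $F(I)$ is isomorphic, as a $k$-algebra, to a polynomial ring over $k$ in $\mu(I)$ variables. A quasi-equigenerated monomial ideal $I$ is called Freiman if $\mu(I^2)=l(I)\mu(I)-\binom{l(I)}{2}$. Theorem. Let $G_1$ and $G_2$ be finite simple graphs with disjoint nonempty vertex sets $V_1$ and $V_2$, and let $G=G_1\oplus G_2$ be their join, that is, the graph on $V_1\cup V_2$ whose edges are those of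 $G_1$, those of $G_2$, and all pairs $\{x,y\}$ with $x\in V_1$ and $y\in V_2$. Suppose that $J(G_1)$ and $J(G_2)$ are quasi-equigenerated. Then the following are equivalent: 1. $J(G)$ is a Freiman ideal. 2. $J(G_1)$ and $J(G_2)$ are both Freiman ideals, and at least one of them is of linear type. -/

import Mathlib

namespace FreimanJoin

open MvPolynomial

section Ideals

variable {σ k : Type*} [Field k]

/-- `I` is a monomial ideal: it is generated by a set of monomials. -/
def IsMonomialIdeal (I : Ideal (MvPolynomial σ k)) : Prop :=
  ∃ S : Set (σ →₀ ℕ), I = Ideal.span ((fun s => monomial s (1 : k)) '' S)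

/-- The exponent vectors of the monomials that lie in `I` and are minimal with respect to
divisibility. For a monomial ideal these are the exponents of its minimal monomial generators. -/
def minimalExponents (I : Ideal (MvPolynomial σ k)) : Set (σ →₀ ℕ) :=
  {s | Minimal (fun t => monomial t (1 : k) ∈ I) s}

/-- `I` is a monomial ideal, and there are positive integer weights of the variables for which all
minimal monomial generators of `I` have the same degree `d`. -/
def IsQuasiEquigenerated (I : Ideal (MvPolynomial σ k)) : Prop :=
  IsMonomialIdeal I ∧
    ∃ α : σ → ℕ, (∀ i, 1 ≤ α i) ∧ ∃ d : ℕ, ∀ s ∈ minimalExponents I, Finsupp.weight α s = d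

/-- The fiber cone `F(I) = ⨁ᵢ Iⁱ / 𝔪 Iⁱ` with `𝔪` the ideal of the variables, as the quotient
`R[It] / 𝔪 R[It]` of the Rees algebra `R[It] = ⨁ᵢ Iⁱ tⁱ`. -/
abbrev FiberCone (I : Ideal (MvPolynomial σ k)) : Type _ :=
  reesAlgebra I ⧸
    (idealOfVars σ k).map (algebraMap (MvPolynomial σ k) (reesAlgebra I))

/-- `μ(I)`, the minimal number of generators of `I`. -/
noncomputable def mu (I : Ideal (MvPolynomial σ k)) : ℕ :=
  Submodule.spanFinrank I

/-- The analytic spread `l(I)`: the Krull dimension of the fiber cone. -/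
noncomputable def analyticSpread (I : Ideal (MvPolynomial σ k)) : WithBot ℕ∞ :=
  ringKrullDim (FiberCone I)

/-- `I` is a quasi-equigenerated monomial ideal such that `μ(I²) = l(I) μ(I) - (l(I) choose 2)`;
the analytic spread is a natural number `l` here. -/
def IsFreiman (I : Ideal (MvPolynomial σ k)) : Prop :=
  IsQuasiEquigenerated I ∧
    ∃ l : ℕ, analyticSpread I = l ∧ (mu (I ^ 2) : ℤ) = l * mu I - l.choose 2

/-- `I` is of linear type, in the sense that its fiber cone is isomorphic to a polynomial ring
over `k` in `μ(I)` variables. -/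
def IsLinearType (I : Ideal (MvPolynomial σ k)) : Prop :=
  Nonempty (FiberCone I ≃ₐ[k] MvPolynomial (Fin (mu I)) k)

end Ideals

section Graphs

variable {V W : Type*}

/-- The cover ideal `J(G) = ⋂_{{u, v} ∈ E(G)} (x_u, x_v)` in the polynomial ring over `k` on the
vertices of `G`. -/
noncomputable def coverIdeal (k : Type*) [Field k] (G : SimpleGraph V) :
    Ideal (MvPolynomial V k) :=
  ⨅ (u : V) (v : V) (_ : G.Adj u v), Ideal.span {X u, X v}

/-- The join of two graphs: their disjoint union together with all edges between the vertices of
the first and the vertices of the second. -/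
def join (G : SimpleGraph V) (H : SimpleGraph W) : SimpleGraph (V ⊕ W) :=
  SimpleGraph.sum G H ⊔ completeBipartiteGraph V W

end Graphs

end FreimanJoin

/-! Let `M` and `N` be the exponent sets of the minimal generators of the two cover ideals.
Everything becomes a question about finite sets of vectors. For weights that make all of `M`
homogeneous, the fiber cone is the toric algebra on the monomials `xˢ t`, `s ∈ M`, so the analytic
spread is the rank `l` of the vectors `(s, 1)` (`analyticSpread_monomialIdeal`). Moreover `μ(I) =
|M|` and `μ(I²) = |M + M|`. Hence Freiman means `|M + M| + (l choose 2) = l |M|`, and linear type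
means `l = |M|`.

A set of vertices covers the join iff it contains one side entirely and covers the other
(`coverIdeal_join`). So the join has exponents `M × {1} ∪ {1} × N`, with `1` the all-ones vector.
For this set cardinalities add, ranks add, and the sumset has `|M + M| + |M| |N| + |N + N|`
elements. Writing the defect of `M` as `|M + M| + (l choose 2) - l |M|`, this gives

defect(join) = defect(M) + defect(N) + (|M| - l(M)) (|N| - l(N)).

Freiman's inequality (`exponentRank_mul_ncard_le`) makes the first two terms nonnegative, and the
product is nonnegative because rank is at most cardinality. The sum vanishes iff all three terms do,
which is the theorem. -/

namespace FreimanJoin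

open MvPolynomial

open scoped Pointwise

/-! ### Krull dimension via Noether normalization and transcendence bases -/

section KrullDimension

/-- Krull dimension is invariant under injective integral extensions. -/
theorem ringKrullDim_eq_of_isIntegral {R S : Type*} [CommRing R] [CommRing S] [Algebra R S]
    [Algebra.IsIntegral R S] (hinj : Function.Injective (algebraMap R S)) :
    ringKrullDim S = ringKrullDim R := by
  refine le_antisymm ?_ ?_
  · exact Order.krullDim_le_of_strictMono (PrimeSpectrum.comap (algebraMap R S))
      fun I J h => Ideal.IsIntegral.comap_lt_comap (R := R) h
  · refine iSup_le fun p => ?_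
    have : FaithfulSMul R S := (faithfulSMul_iff_algebraMap_injective R S).2 hinj
    obtain ⟨P, hP, hPp⟩ := (inferInstance : Nonempty (p.head.asIdeal.primesOver S))
    obtain ⟨q, hq, -⟩ := Ideal.exists_ltSeries_of_hasGoingUp p P
    rw [← hq]
    exact le_iSup (fun q : LTSeries (PrimeSpectrum S) => (q.length : WithBot ℕ∞)) q

/-- The Krull dimension of a finitely generated domain over a field is the number of elements of
any transcendence basis. -/
theorem ringKrullDim_eq_card_of_isTranscendenceBasis {k A ι : Type*} [Field k] [CommRing A]
    [IsDomain A] [Algebra k A] [Algebra.FiniteType k A] {x : ι → A}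
    (hx : IsTranscendenceBasis k x) : ringKrullDim A = (Nat.card ι : ℕ) := by
  obtain ⟨s, g, hg, hint⟩ := exists_integral_inj_algHom_of_fg k A
  algebraize [g.toRingHom]
  have hinj : Function.Injective (algebraMap (MvPolynomial (Fin s) k) A) := hg
  -- The variables of the Noether normalization form a second transcendence basis, so their number
  -- `s` is the cardinality of `ι`.
  have : IsScalarTower k (MvPolynomial (Fin s) k) A :=
    IsScalarTower.of_algebraMap_eq fun r => (g.commutes r).symm
  have : FaithfulSMul (MvPolynomial (Fin s) k) A :=
    (faithfulSMul_iff_algebraMap_injective _ _).2 hinj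
  have hX := (IsTranscendenceBasis.mvPolynomial (Fin s) k).algebraMap_comp (A := A)
  have hcard := hx.lift_cardinalMk_eq hX
  have : Nat.card ι = s := by
    have := congrArg Cardinal.toNat hcard
    simpa [Nat.card] using this
  rw [ringKrullDim_eq_of_isIntegral hinj, MvPolynomial.ringKrullDim_of_isNoetherianRing,
    ringKrullDim_eq_zero_of_field, this]
  simp

end KrullDimension

/-! ### Freiman's inequality -/

section Freiman

/-- If the sum of the least element `x` with `y` is not a sum of two elements above `x`, call `y`
a neighbour of `x`; the neighbours of `x` span the same space as the whole set. -/
theorem span_neighbours_eq {K W : Type*} [Field K] [AddCommGroup W] [Module K W] [LinearOrder W]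
    [IsOrderedAddMonoid W] [DecidableEq W] (X : Finset W) (x : W) (hx : ∀ y ∈ X, x < y) :
    Submodule.span K (((insert x X).filter fun y => x + y ∉ X + X : Finset W) : Set W) =
      Submodule.span K ((insert x X : Finset W) : Set W) := by
  set Y := (insert x X).filter fun y => x + y ∉ X + X with hY
  refine le_antisymm (Submodule.span_mono (Finset.coe_subset.2 (Finset.filter_subset _ _))) (Submodule.span_le.2 ?_)
  -- Induction on the number of elements below `y`. If `x + y = u + v` with `u, v ∈ X`, then `u, v >
  -- x` forces `u, v < y`, so `y = u + v - x` is a combination of smaller elements.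
  have key : ∀ n, ∀ y ∈ insert x X, ((insert x X).filter (· < y)).card = n →
      y ∈ Submodule.span K (Y : Set W) := by
    intro n
    induction n using Nat.strong_induction_on with
    | _ n ih =>
      intro y hy hn
      by_cases hyY : y ∈ Y
      · exact Submodule.subset_span hyY
      have hsum : x + y ∈ X + X := by
        by_contra h
        exact hyY (Finset.mem_filter.2 ⟨hy, h⟩)
      have below : ∀ u ∈ insert x X, u < y → u ∈ Submodule.span K (Y : Set W) := by
        intro u hu huy
        refine ih _ ?_ u hu rfl
        rw [← hn]
        refine Finset.card_lt_card (Finset.ssubset_iff_of_subset ?_ |>.2 ⟨u, ?_, ?_⟩)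
        · intro z hz
          rw [Finset.mem_filter] at hz ⊢
          exact ⟨hz.1, hz.2.trans huy⟩
        · exact Finset.mem_filter.2 ⟨hu, huy⟩
        · simp
      obtain ⟨u, hu, v, hv, huv⟩ := Finset.mem_add.1 hsum
      have huy : u < y := by
        by_contra h
        have := add_lt_add_of_lt_of_le (hx v hv) (not_lt.1 h)
        rw [add_comm v, huv] at this
        exact this.false
      have hvy : v < y := by
        by_contra h
        have := add_lt_add_of_lt_of_le (hx u hu) (not_lt.1 h)
        rw [huv] at this
        exact this.false
      have hxy : x < y := (hx u hu).trans huy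
      have hyx : y = u + v - x := by rw [huv]; abel
      rw [hyx]
      exact Submodule.sub_mem _ (Submodule.add_mem _ (below u (Finset.mem_insert_of_mem hu) huy)
        (below v (Finset.mem_insert_of_mem hv) hvy)) (below x (Finset.mem_insert_self _ _) hxy)
  exact fun y hy => key _ y hy rfl

/-- **Freiman's inequality** in homogeneous form, for a finite subset of an ordered vector space. -/
theorem freiman_inequality_of_linearOrder {K W : Type*} [Field K] [AddCommGroup W] [Module K W]
    [LinearOrder W] [IsOrderedAddMonoid W] [DecidableEq W] (X : Finset W) :
    Module.finrank K (Submodule.span K (X : Set W)) * X.card ≤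
      (X + X).card + (Module.finrank K (Submodule.span K (X : Set W))).choose 2 := by
  induction X using Finset.induction_on_min with
  | empty => simp
  | insert x X hx ih =>
    have hxX : x ∉ X := fun h => (hx x h).false
    set Y := (insert x X).filter fun y => x + y ∉ X + X with hY
    -- Each neighbour `y` of the new minimum contributes a sum `x + y` outside `X + X`.
    have hcard : (X + X).card + Y.card ≤ (insert x X + insert x X).card := by
      rw [← Finset.card_image_of_injective Y (add_right_injective x),
        ← Finset.card_union_of_disjoint]
      · refine Finset.card_le_card (Finset.union_subset
          (Finset.add_subset_add (Finset.subset_insert _ _) (Finset.subset_insert _ _)) ?_)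
        intro z hz
        obtain ⟨y, hy, rfl⟩ := Finset.mem_image.1 hz
        exact Finset.add_mem_add (Finset.mem_insert_self _ _) (Finset.mem_filter.1 hy).1
      · rw [Finset.disjoint_right]
        intro z hz
        obtain ⟨y, hy, rfl⟩ := Finset.mem_image.1 hz
        exact (Finset.mem_filter.1 hy).2
    rw [Finset.card_insert_of_notMem hxX]
    -- If the rank `r` does not change, at least `r` new sums are needed, and the neighbours suffice
    -- because they span. If the rank grows, every element is a neighbour.
    by_cases hmem : x ∈ Submodule.span K (X : Set W)
    · have hspan : Submodule.span K ((insert x X : Finset W) : Set W) =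
          Submodule.span K (X : Set W) := by
        rw [Finset.coe_insert, Submodule.span_insert_eq_span hmem]
      have hle : Module.finrank K (Submodule.span K (X : Set W)) ≤ Y.card := by
        rw [← hspan, ← span_neighbours_eq X x hx]
        exact finrank_span_finset_le_card Y
      rw [hspan]
      rw [mul_add, mul_one]
      omega
    -- For `y ∈ X`, `x + y ∈ X + X` would put `x = (x + y) - y` in the span; and `x + x` is smaller
    -- than every element of `X + X`.
    · have hYX : Y = insert x X := by
        refine Finset.filter_true_of_mem fun y hy h => hmem ?_
        have hXX : x + y ∈ Submodule.span K (X : Set W) := by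
          obtain ⟨u, hu, v, hv, huv⟩ := Finset.mem_add.1 h
          rw [← huv]
          exact Submodule.add_mem _ (Submodule.subset_span hu) (Submodule.subset_span hv)
        rcases Finset.mem_insert.1 hy with rfl | hy
        · obtain ⟨u, hu, v, hv, huv⟩ := Finset.mem_add.1 h
          exact absurd huv (add_lt_add (hx u hu) (hx v hv)).ne'
        · simpa using Submodule.sub_mem _ hXX (Submodule.subset_span hy)
      have hfin : Module.finrank K (Submodule.span K ((insert x X : Finset W) : Set W)) =
          Module.finrank K (Submodule.span K (X : Set W)) + 1 := by
        have hx0 : x ≠ 0 := fun h => hmem (h ▸ Submodule.zero_mem _)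
        have hd : Submodule.span K {x} ⊓ Submodule.span K (X : Set W) = ⊥ :=
          disjoint_iff.1 ((Submodule.disjoint_span_singleton' hx0).2 hmem).symm
        have := Submodule.finrank_sup_add_finrank_inf_eq (Submodule.span K {x})
          (Submodule.span K (X : Set W))
        rw [hd, finrank_bot, finrank_span_singleton hx0] at this
        rw [Finset.coe_insert, Submodule.span_insert]
        omega
      rw [hYX, Finset.card_insert_of_notMem hxX] at hcard
      rw [hfin, Nat.choose_succ_succ' _ 1, Nat.choose_one_right]
      nlinarith

/-- **Freiman's inequality** in homogeneous form. -/
theorem freiman_inequality {W : Type*} [AddCommGroup W] [Module ℚ W] [Module.Finite ℚ W]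
    (X : Set W) (hX : X.Finite) :
    Module.finrank ℚ (Submodule.span ℚ X) * X.ncard ≤
      (X + X).ncard + (Module.finrank ℚ (Submodule.span ℚ X)).choose 2 := by
  classical
  -- The lexicographic order on coordinates supplies the translation-invariant linear order.
  let e : W ≃ₗ[ℚ] Lex (Fin (Module.finrank ℚ W) → ℚ) :=
    (Module.finBasis ℚ W).equivFun.trans (toLexLinearEquiv ℚ _)
  let Z := hX.toFinset.image e
  have hZ : (Z : Set (Lex (Fin (Module.finrank ℚ W) → ℚ))) = e '' X := by simp [Z]
  have h := freiman_inequality_of_linearOrder (K := ℚ) Z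
  have hspan : Module.finrank ℚ (Submodule.span ℚ (Z : Set (Lex (Fin (Module.finrank ℚ W) → ℚ)))) =
      Module.finrank ℚ (Submodule.span ℚ X) := by
    rw [hZ, show e '' X = e.toLinearMap '' X from rfl, Submodule.span_image]
    exact LinearEquiv.finrank_map_eq e _
  have hc1 : Z.card = X.ncard := by
    rw [← Set.ncard_coe_finset, hZ, Set.ncard_image_of_injective _ e.injective]
  have hc2 : (Z + Z).card = (X + X).ncard := by
    rw [← Set.ncard_coe_finset, Finset.coe_add, hZ, ← Set.image_add,
      Set.ncard_image_of_injective _ e.injective]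
  rwa [hspan, hc1, hc2] at h

end Freiman

/-! ### Krull dimension as a linear rank -/

section KrullDimension

universe u

/-- If algebraic independence of generators of a domain is governed by linear independence of
vectors, then the Krull dimension is the rank of these vectors. -/
theorem ringKrullDim_eq_finrank_of_algebraicIndependent_iff {k A K W : Type*} {ι : Type u}
    [Field k] [CommRing A] [IsDomain A] [Algebra k A] [Field K] [AddCommGroup W] [Module K W]
    [Module.Finite K W] [Finite ι] {x : ι → A} (hx : Algebra.adjoin k (Set.range x) = ⊤)
    (v : ι → W) (h : ∀ (κ : Type u) (w : κ → ι),
      AlgebraicIndependent k (fun i => x (w i)) ↔ LinearIndependent K (fun i => v (w i))) :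
    ringKrullDim A = (Module.finrank K (Submodule.span K (Set.range v)) : ℕ) := by
  have : Algebra.FiniteType k A :=
    ⟨⟨(Set.finite_range x).toFinset, by rw [Set.Finite.coe_toFinset, hx]⟩⟩
  have hint : Algebra.IsAlgebraic (Algebra.adjoin k (Set.range x)) A := by
    rw [hx]
    exact ⟨fun a => isAlgebraic_algebraMap (⟨a, trivial⟩ : (⊤ : Subalgebra k A))⟩
  -- A transcendence basis chosen among the generators gives independent vectors, hence one
  -- inequality; a maximal independent subfamily of `v` gives the other.
  obtain ⟨T, hT, hbasis⟩ := exists_isTranscendenceBasis_subset (R := k) (Set.range x)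
  rw [ringKrullDim_eq_card_of_isTranscendenceBasis hbasis]
  have hTfin : Finite T := (Set.finite_range _).subset hT
  congr 2
  choose u hu using fun t : T => hT t.2
  have hui : Function.Injective u := fun a b hab => Subtype.ext (by rw [← hu, ← hu, hab])
  refine le_antisymm ?_ ?_
  · have hli : LinearIndependent K fun t : Set.range u => v t := by
      rw [← h, ← algebraicIndependent_equiv (Equiv.ofInjective u hui)]
      convert hbasis.1 using 1
      exact funext hu
    have := Fintype.ofFinite (Set.range u)
    rw [Nat.card_congr (Equiv.ofInjective u hui), Nat.card_eq_fintype_card,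
      ← finrank_span_eq_card hli]
    refine Submodule.finrank_mono (Submodule.span_mono ?_)
    rintro _ ⟨t, rfl⟩
    exact ⟨t, rfl⟩
  · obtain ⟨κ, w, hw, hspan, hli⟩ := exists_linearIndependent' K v
    have := Finite.of_injective w hw
    have := Fintype.ofFinite κ
    have hle := ((h κ w).2 hli).lift_cardinalMk_le_trdeg
    rw [← hbasis.cardinalMk_eq_trdeg] at hle
    rw [← hspan, finrank_span_eq_card hli, ← Nat.card_eq_fintype_card]
    have := Cardinal.toNat_le_toNat hle (by simp)
    simpa [Nat.card] using this

theorem algebraicIndependent_coe_iff {ι R A : Type*} [CommRing R] [CommRing A] [Algebra R A]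
    {S : Subalgebra R A} {x : ι → S} :
    AlgebraicIndependent R (fun i => (x i : A)) ↔ AlgebraicIndependent R x :=
  S.val.algebraicIndependent_iff Subtype.val_injective

end KrullDimension

/-! ### Toric algebras: algebraic independence of monomials is linear independence of exponents -/

section Toric

variable {σ k ι : Type*} [Field k]

variable (k) in
/-- The monomial `xˢ tⁿ` of `k[x][t]`. -/
noncomputable def reesMonomial (q : (σ →₀ ℕ) × ℕ) : Polynomial (MvPolynomial σ k) :=
  Polynomial.monomial q.2 (monomial q.1 1)

theorem reesMonomial_zero : reesMonomial k (0 : (σ →₀ ℕ) × ℕ) = 1 := by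
  simp [reesMonomial]

theorem reesMonomial_add (q r : (σ →₀ ℕ) × ℕ) :
    reesMonomial k (q + r) = reesMonomial k q * reesMonomial k r := by
  simp [reesMonomial, Polynomial.monomial_mul_monomial, monomial_mul]

theorem reesMonomial_nsmul (q : (σ →₀ ℕ) × ℕ) (n : ℕ) :
    reesMonomial k (n • q) = reesMonomial k q ^ n := by
  induction n with
  | zero => simp [reesMonomial_zero]
  | succ n ih => rw [succ_nsmul, reesMonomial_add, ih, pow_succ]

theorem coeff_coeff_reesMonomial (q : (σ →₀ ℕ) × ℕ) (m : σ →₀ ℕ) (n : ℕ) [Decidable (q = (m, n))] :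
    coeff m ((reesMonomial k q).coeff n) = if q = (m, n) then 1 else 0 := by
  classical
  rw [reesMonomial, Polynomial.coeff_monomial]
  by_cases h : q.2 = n
  · by_cases h' : q.1 = m
    · rw [if_pos h, if_pos (Prod.ext h' h), coeff_monomial, if_pos h']
    · rw [if_pos h, if_neg fun h'' => h' (congrArg Prod.fst h''), coeff_monomial, if_neg h']
  · rw [if_neg h, if_neg fun h'' => h (congrArg Prod.snd h''), coeff_zero]

theorem reesMonomial_injective :
    Function.Injective (reesMonomial k : (σ →₀ ℕ) × ℕ → Polynomial (MvPolynomial σ k)) := by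
  classical
  intro q r h
  have := coeff_coeff_reesMonomial (k := k) q r.1 r.2
  rw [h, coeff_coeff_reesMonomial, if_pos rfl] at this
  by_contra hne
  rw [if_neg hne] at this
  exact one_ne_zero this

theorem reesMonomial_linearCombination (e : ι → (σ →₀ ℕ) × ℕ) (a : ι →₀ ℕ) :
    reesMonomial k (Finsupp.linearCombination ℕ e a) =
      a.prod fun i n => reesMonomial k (e i) ^ n := by
  classical
  induction a using Finsupp.induction_linear with
  | zero => simp [reesMonomial_zero]
  | add a b ha hb =>
    rw [map_add, reesMonomial_add, ha, hb, Finsupp.prod_add_index' (by simp)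
      (fun i m n => pow_add _ m n)]
  | single i n => simp [reesMonomial_nsmul]

theorem aeval_reesMonomial_monomial (e : ι → (σ →₀ ℕ) × ℕ) (a : ι →₀ ℕ) (c : k) :
    aeval (fun i => reesMonomial k (e i)) (monomial a c) =
      c • reesMonomial k (Finsupp.linearCombination ℕ e a) := by
  rw [aeval_monomial, reesMonomial_linearCombination, Algebra.smul_def]

/-- Distinct monomials in the generators go to distinct monomials of `k[x][t]`, so no cancellation
occurs and `p` can be recovered from its image. -/
theorem coeff_coeff_aeval_reesMonomial (e : ι → (σ →₀ ℕ) × ℕ)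
    (he : Function.Injective (Finsupp.linearCombination ℕ e)) (p : MvPolynomial ι k)
    (a : ι →₀ ℕ) :
    coeff (Finsupp.linearCombination ℕ e a).1
      ((aeval (fun i => reesMonomial k (e i)) p).coeff (Finsupp.linearCombination ℕ e a).2) =
      coeff a p := by
  classical
  induction p using MvPolynomial.induction_on' with
  | monomial b c =>
    rw [aeval_reesMonomial_monomial, Polynomial.coeff_smul, coeff_smul, coeff_coeff_reesMonomial,
      coeff_monomial]
    simp [he.eq_iff]
  | add p q hp hq => simp [hp, hq]

/-- Monomials are algebraically independent if and only if their exponents are independent. -/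
theorem algebraicIndependent_reesMonomial_iff (e : ι → (σ →₀ ℕ) × ℕ) :
    AlgebraicIndependent k (fun i => reesMonomial k (e i)) ↔ LinearIndependent ℕ e := by
  rw [AlgebraicIndependent, LinearIndependent]
  refine ⟨fun h a b hab => ?_, fun h p q hpq => ?_⟩
  · have : monomial a (1 : k) = monomial b 1 :=
      h (by rw [aeval_reesMonomial_monomial, aeval_reesMonomial_monomial, hab])
    exact monomial_left_injective one_ne_zero this
  · ext a
    rw [← coeff_coeff_aeval_reesMonomial e h, hpq, coeff_coeff_aeval_reesMonomial e h]

/-- The inclusion of exponents of `k[x][t]` into a rational vector space. -/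
def expVector : ((σ →₀ ℕ) × ℕ) →+ (σ → ℚ) × ℚ where
  toFun q := (fun i => q.1 i, q.2)
  map_zero' := by ext <;> simp
  map_add' q r := by ext <;> simp

theorem expVector_injective : Function.Injective (expVector (σ := σ)) := by
  intro q r h
  have h1 : ∀ i, (q.1 i : ℚ) = r.1 i := congrFun (congrArg Prod.fst h)
  have h2 : (q.2 : ℚ) = r.2 := congrArg Prod.snd h
  exact Prod.ext (Finsupp.ext fun i => Nat.cast_injective (h1 i)) (Nat.cast_injective h2)

/-- An integer relation splits into its positive and negative parts `p` and `n`, which form a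
relation between two combinations over `ℕ`. -/
theorem linearIndependent_int_iff_nat {W : Type*} [AddCommGroup W] (v : ι → W) :
    LinearIndependent ℤ v ↔ LinearIndependent ℕ v := by
  refine ⟨fun h => h.restrict_scalars (by intro a b hab; simpa using hab), fun h => ?_⟩
  rw [linearIndependent_iff]
  intro l hl
  let p : ι →₀ ℕ := l.mapRange Int.toNat rfl
  let n : ι →₀ ℕ := l.mapRange (fun z => (-z).toNat) rfl
  have key : ∀ a : ι →₀ ℕ, Finsupp.linearCombination ℤ v (a.mapRange (Nat.cast : ℕ → ℤ) rfl) =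
      Finsupp.linearCombination ℕ v a := by
    intro a
    rw [Finsupp.linearCombination_apply, Finsupp.linearCombination_apply,
      Finsupp.sum_mapRange_index (by simp)]
    simp
  have hlpn : l = p.mapRange (Nat.cast : ℕ → ℤ) rfl - n.mapRange (Nat.cast : ℕ → ℤ) rfl := by
    ext i
    simp only [p, n, Finsupp.coe_sub, Pi.sub_apply, Finsupp.mapRange_apply]
    omega
  have hpn : p = n := by
    refine h ?_
    rw [← key, ← key, ← sub_eq_zero, ← map_sub, ← hlpn, hl]
  rw [hlpn, hpn, sub_self]

theorem linearIndependent_expVector_iff (e : ι → (σ →₀ ℕ) × ℕ) :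
    LinearIndependent ℚ (fun i => expVector (e i)) ↔ LinearIndependent ℕ e := by
  rw [← LinearIndependent.iff_fractionRing ℤ ℚ, linearIndependent_int_iff_nat]
  exact LinearMap.linearIndependent_iff_of_injOn expVector.toNatLinearMap
    expVector_injective.injOn

/-- The dimension of the rational span of the vectors `(s, 1)` for `s` in `M`. -/
noncomputable def exponentRank (M : Set (σ →₀ ℕ)) : ℕ :=
  Module.finrank ℚ (Submodule.span ℚ ((fun s => expVector (s, 1)) '' M))

variable (k) in
/-- The algebra generated by the monomials `xˢ t` for `s` in `M`. -/
noncomputable def toricAlgebra (M : Set (σ →₀ ℕ)) :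
    Subalgebra k (Polynomial (MvPolynomial σ k)) :=
  Algebra.adjoin k (Set.range fun s : M => reesMonomial k ((s : σ →₀ ℕ), 1))

variable (k) in
/-- The generators of the toric algebra. -/
noncomputable def toricGenerator (M : Set (σ →₀ ℕ)) (s : M) : toricAlgebra k M :=
  ⟨reesMonomial k (s, 1), Algebra.subset_adjoin ⟨s, rfl⟩⟩

theorem adjoin_toricGenerator (M : Set (σ →₀ ℕ)) :
    Algebra.adjoin k (Set.range (toricGenerator k M)) = ⊤ := by
  have h := Algebra.adjoin_adjoin_coe_preimage (R := k)
    (s := Set.range fun s : M => reesMonomial k ((s : σ →₀ ℕ), 1))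
  refine Eq.trans ?_ h
  congr 1
  ext x
  constructor
  · rintro ⟨s, rfl⟩
    exact ⟨s, rfl⟩
  · rintro ⟨s, hs⟩
    exact ⟨s, Subtype.ext hs⟩

theorem algebraicIndependent_toricGenerator_iff (M : Set (σ →₀ ℕ)) (u : ι → M) :
    AlgebraicIndependent k (fun i => toricGenerator k M (u i)) ↔
      LinearIndependent ℚ (fun i => expVector ((u i : σ →₀ ℕ), 1)) := by
  rw [linearIndependent_expVector_iff, ← algebraicIndependent_reesMonomial_iff (k := k),
    ← algebraicIndependent_coe_iff]
  rfl

instance (M : Set (σ →₀ ℕ)) : IsDomain (toricAlgebra k M) :=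
  Subalgebra.isDomain _

theorem ringKrullDim_toricAlgebra [Finite σ] {M : Set (σ →₀ ℕ)} (hM : M.Finite) :
    ringKrullDim (toricAlgebra k M) = (exponentRank M : ℕ) := by
  have := hM.to_subtype
  have := Fintype.ofFinite σ
  rw [ringKrullDim_eq_finrank_of_algebraicIndependent_iff (adjoin_toricGenerator (k := k) M)
    (fun s : M => expVector ((s : σ →₀ ℕ), 1))
    (fun _ w => algebraicIndependent_toricGenerator_iff M w), exponentRank, Set.image_eq_range]

end Toric

/-! ### The fiber cone of a quasi-equigenerated monomial ideal -/

section FiberCone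

variable {σ k : Type*} [Field k]

theorem weight_le_weight_of_le (α : σ → ℕ) {s t : σ →₀ ℕ} (h : s ≤ t) :
    Finsupp.weight α s ≤ Finsupp.weight α t := by
  obtain ⟨u, rfl⟩ := exists_add_of_le h
  rw [map_add]
  exact Nat.le_add_right _ _

/-- Every monomial `xᵐ tⁿ` occurring in `f` has weight at least `d n + c` in `x`. -/
def IsWeightBounded (α : σ → ℕ) (d c : ℕ) (f : Polynomial (MvPolynomial σ k)) : Prop :=
  ∀ n m, coeff m (f.coeff n) ≠ 0 → d * n + c ≤ Finsupp.weight α m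

namespace IsWeightBounded

variable {α : σ → ℕ} {d c c' : ℕ} {f g : Polynomial (MvPolynomial σ k)}

theorem zero : IsWeightBounded α d c (0 : Polynomial (MvPolynomial σ k)) := by
  intro n m h
  simp at h

theorem add (hf : IsWeightBounded α d c f) (hg : IsWeightBounded α d c g) :
    IsWeightBounded α d c (f + g) := by
  intro n m h
  rw [Polynomial.coeff_add, coeff_add] at h
  by_cases hfm : coeff m (f.coeff n) = 0
  · exact hg n m (by simpa [hfm] using h)
  · exact hf n m hfm

theorem mul (hf : IsWeightBounded α d c f) (hg : IsWeightBounded α d c' g) :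
    IsWeightBounded α d (c + c') (f * g) := by
  classical
  intro n m h
  rw [Polynomial.coeff_mul, coeff_sum] at h
  obtain ⟨⟨i, j⟩, hij, h⟩ := Finset.exists_ne_zero_of_sum_ne_zero h
  rw [coeff_mul] at h
  obtain ⟨⟨a, b⟩, hab, h⟩ := Finset.exists_ne_zero_of_sum_ne_zero h
  rw [Finset.HasAntidiagonal.mem_antidiagonal] at hij hab
  simp only at hij hab h
  have h1 := hf i a (left_ne_zero_of_mul h)
  have h2 := hg j b (right_ne_zero_of_mul h)
  rw [← hij, ← hab, map_add]
  linarith [mul_add d i j]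

theorem C_of_forall {r : MvPolynomial σ k} (h : ∀ m, coeff m r ≠ 0 → c ≤ Finsupp.weight α m) :
    IsWeightBounded α d c (Polynomial.C r) := by
  intro n m hm
  rw [Polynomial.coeff_C] at hm
  split_ifs at hm with hn
  · simpa [hn] using h m hm
  · simp at hm

end IsWeightBounded

/-- The monomial ideal generated by the monomials with exponents in `M`. -/
noncomputable abbrev monomialIdeal (k : Type*) [Field k] (M : Set (σ →₀ ℕ)) : Ideal (MvPolynomial σ k) :=
  Ideal.span ((fun s => monomial s (1 : k)) '' M)

theorem monomial_mem_monomialIdeal_iff {M : Set (σ →₀ ℕ)} {t : σ →₀ ℕ} :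
    monomial t (1 : k) ∈ monomialIdeal k M ↔ ∃ s ∈ M, s ≤ t := by
  classical
  rw [mem_ideal_span_monomial_image, support_monomial, if_neg one_ne_zero]
  simp

variable {α : σ → ℕ} {d : ℕ} {M : Set (σ →₀ ℕ)}

theorem isWeightBounded_of_mem_reesAlgebra (hM : ∀ s ∈ M, Finsupp.weight α s = d)
    {f : Polynomial (MvPolynomial σ k)} (hf : f ∈ reesAlgebra (monomialIdeal k M)) :
    IsWeightBounded α d 0 f := by
  rw [← adjoin_monomial_eq_reesAlgebra] at hf
  induction hf using Algebra.adjoin_induction with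
  | mem f hf =>
    obtain ⟨r, hr, rfl⟩ := hf
    intro n m h
    rw [Polynomial.coeff_monomial] at h
    split_ifs at h with hn
    · obtain ⟨s, hs, hsm⟩ := mem_ideal_span_monomial_image.1 hr m (mem_support_iff.2 h)
      have := weight_le_weight_of_le α hsm
      rw [hM s hs] at this
      rwa [← hn, mul_one, add_zero]
    · simp at h
  | algebraMap r => exact .C_of_forall fun _ _ => Nat.zero_le _
  | add f g _ _ hf hg => exact hf.add hg
  | mul f g _ _ hf hg => exact hf.mul hg

theorem isWeightBounded_of_mem_map_idealOfVars (hα : ∀ i, 1 ≤ α i)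
    (hM : ∀ s ∈ M, Finsupp.weight α s = d) {f : reesAlgebra (monomialIdeal k M)}
    (hf : f ∈ (idealOfVars σ k).map
      (algebraMap (MvPolynomial σ k) (reesAlgebra (monomialIdeal k M)))) :
    IsWeightBounded α d 1 (f : Polynomial (MvPolynomial σ k)) := by
  classical
  rw [idealOfVars, Ideal.map_span] at hf
  induction hf using Submodule.span_induction with
  | mem f hf =>
    obtain ⟨_, ⟨i, rfl⟩, rfl⟩ := hf
    refine IsWeightBounded.C_of_forall fun m hm => ?_
    rw [coeff_X, Ne, ite_eq_right_iff, Classical.not_imp] at hm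
    rw [← hm.1, Finsupp.weight_single]
    simpa using hα i
  | zero => exact .zero
  | add f g _ _ hf hg => exact hf.add hg
  | smul r f _ hf => exact (isWeightBounded_of_mem_reesAlgebra hM r.2).mul hf

theorem weight_eq_of_mem_toricAlgebra (hM : ∀ s ∈ M, Finsupp.weight α s = d)
    {f : Polynomial (MvPolynomial σ k)} (hf : f ∈ toricAlgebra k M) (n : ℕ) (m : σ →₀ ℕ)
    (h : coeff m (f.coeff n) ≠ 0) : Finsupp.weight α m = d * n := by
  classical
  rw [toricAlgebra, Algebra.adjoin_range_eq_range_aeval] at hf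
  obtain ⟨p, rfl⟩ := hf
  induction p using MvPolynomial.induction_on' with
  | monomial a c =>
    rw [AlgHom.toRingHom_eq_coe, RingHom.coe_coe] at h
    rw [aeval_reesMonomial_monomial (fun s : M => ((s : σ →₀ ℕ), 1)), Polynomial.coeff_smul,
      coeff_smul, coeff_coeff_reesMonomial] at h
    have h : Finsupp.linearCombination ℕ (fun s : M => ((s : σ →₀ ℕ), 1)) a = (m, n) := by
      by_contra hne
      simp [hne] at h
    have key : ∀ a, Finsupp.weight α
        (Finsupp.linearCombination ℕ (fun s : M => ((s : σ →₀ ℕ), 1)) a).1 =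
        d * (Finsupp.linearCombination ℕ (fun s : M => ((s : σ →₀ ℕ), 1)) a).2 := by
      intro a
      induction a using Finsupp.induction_linear with
      | zero => simp
      | add a b ha hb => rw [map_add, Prod.fst_add, Prod.snd_add, map_add, ha, hb, mul_add]
      | single s j => simp [hM s s.2, mul_comm]
    have := key a
    rwa [h] at this
  | add p q hp hq =>
    simp only [AlgHom.toRingHom_eq_coe, RingHom.coe_coe, map_add, Polynomial.coeff_add,
      coeff_add] at h hp hq
    by_contra hne
    refine h ?_
    rw [not_imp_comm.1 hp hne, not_imp_comm.1 hq hne, add_zero]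

theorem toricAlgebra_le_reesAlgebra (M : Set (σ →₀ ℕ)) :
    toricAlgebra k M ≤ (reesAlgebra (monomialIdeal k M)).restrictScalars k := by
  refine Algebra.adjoin_le ?_
  rintro _ ⟨s, rfl⟩
  refine reesAlgebra.monomial_mem.2 ?_
  rw [pow_one]
  exact Ideal.subset_span ⟨s, s.2, rfl⟩

variable (k M) in
/-- The comparison map from the toric algebra to the fiber cone. -/
noncomputable def toricToFiberCone : toricAlgebra k M →ₐ[k] FiberCone (monomialIdeal k M) :=
  (Ideal.Quotient.mkₐ k _).comp (Subalgebra.inclusion (toricAlgebra_le_reesAlgebra M))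

/-- In `t`-degree `n`, the toric algebra lives in weight exactly `d n`, while `𝔪 R[It]` lives in
weight at least `d n + 1`, since every variable has positive weight. -/
theorem toricToFiberCone_injective (hα : ∀ i, 1 ≤ α i) (hM : ∀ s ∈ M, Finsupp.weight α s = d) :
    Function.Injective (toricToFiberCone k M) := by
  rw [injective_iff_map_eq_zero]
  intro f hf
  have hmem := Ideal.Quotient.eq_zero_iff_mem.1 hf
  have hb := isWeightBounded_of_mem_map_idealOfVars hα hM hmem
  refine Subtype.ext (Polynomial.ext fun n => MvPolynomial.ext _ _ fun m => ?_)
  by_contra hne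
  have h1 := hb n m hne
  have h2 := weight_eq_of_mem_toricAlgebra hM f.2 n m hne
  omega

theorem toricToFiberCone_surjective (M : Set (σ →₀ ℕ)) :
    Function.Surjective (toricToFiberCone k M) := by
  -- Modulo `𝔪` a polynomial agrees with its constant term, so coefficients from `R` act as scalars
  -- of `k`.
  have hC : ∀ r : MvPolynomial σ k, Ideal.Quotient.mk _
      (algebraMap (MvPolynomial σ k) (reesAlgebra (monomialIdeal k M)) r) ∈
      (toricToFiberCone k M).range := by
    intro r
    refine ⟨algebraMap k _ (constantCoeff r), ?_⟩
    rw [AlgHom.toRingHom_eq_coe, RingHom.coe_coe, AlgHom.commutes]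
    refine Ideal.Quotient.eq.2 ?_
    change algebraMap (MvPolynomial σ k) (reesAlgebra (monomialIdeal k M))
      (C (constantCoeff r)) - _ ∈ _
    rw [← map_sub]
    refine Ideal.mem_map_of_mem _ ?_
    rw [idealOfVars, ← Set.image_univ, mem_ideal_span_X_image]
    intro m hm
    by_contra hne
    have : m = 0 := by
      ext i
      by_contra hi
      exact hne ⟨i, trivial, hi⟩
    subst this
    rw [mem_support_iff, coeff_sub, coeff_zero_C, ← constantCoeff_eq, sub_self] at hm
    exact hm rfl
  rintro ⟨f, hf⟩
  have hf' := hf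
  rw [← adjoin_monomial_eq_reesAlgebra] at hf'
  suffices h : ∀ hf : f ∈ reesAlgebra (monomialIdeal k M),
      Ideal.Quotient.mk _ (⟨f, hf⟩ : reesAlgebra (monomialIdeal k M)) ∈
        (toricToFiberCone k M).range from h hf
  clear hf
  induction hf' using Algebra.adjoin_induction with
  | mem f hf =>
    obtain ⟨r, hr, rfl⟩ := hf
    induction hr using Submodule.span_induction with
    | mem r hr =>
      obtain ⟨s, hs, rfl⟩ := hr
      intro _
      exact ⟨toricGenerator k M ⟨s, hs⟩, rfl⟩
    | zero =>
      intro _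
      convert Subalgebra.zero_mem _
      rw [← map_zero (Ideal.Quotient.mk _)]
      congr 1
      exact Subtype.ext (map_zero _)
    | add p q hp hq hp' hq' =>
      intro _
      have h1 := hp' (reesAlgebra.monomial_mem.2 (by rwa [pow_one]))
      have h2 := hq' (reesAlgebra.monomial_mem.2 (by rwa [pow_one]))
      convert Subalgebra.add_mem _ h1 h2
      rw [← map_add]
      congr 1
      exact Subtype.ext (map_add _ _ _)
    | smul a p hp hp' =>
      intro _
      have h1 := hp' (reesAlgebra.monomial_mem.2 (by rwa [pow_one]))
      convert Subalgebra.mul_mem _ (hC a) h1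
      rw [← map_mul]
      congr 1
      exact Subtype.ext (by simp [Polynomial.C_mul_monomial])
  | algebraMap r => exact fun _ => hC r
  | add f g hf hg hf' hg' =>
    intro _
    rw [adjoin_monomial_eq_reesAlgebra] at hf hg
    convert Subalgebra.add_mem _ (hf' hf) (hg' hg)
    rw [← map_add]
    rfl
  | mul f g hf hg hf' hg' =>
    intro _
    rw [adjoin_monomial_eq_reesAlgebra] at hf hg
    convert Subalgebra.mul_mem _ (hf' hf) (hg' hg)
    rw [← map_mul]
    rfl

/-- The fiber cone of a quasi-equigenerated monomial ideal is a toric algebra. -/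
theorem nonempty_toricAlgebra_algEquiv_fiberCone (hα : ∀ i, 1 ≤ α i)
    (hM : ∀ s ∈ M, Finsupp.weight α s = d) :
    Nonempty (toricAlgebra k M ≃ₐ[k] FiberCone (monomialIdeal k M)) :=
  ⟨AlgEquiv.ofBijective (toricToFiberCone k M)
    ⟨toricToFiberCone_injective hα hM, toricToFiberCone_surjective M⟩⟩

end FiberCone

/-! ### Numerical invariants of a monomial ideal in terms of its exponents -/

section MonomialIdeal

variable {σ k : Type*} [Field k] {α : σ → ℕ} {d : ℕ} {M : Set (σ →₀ ℕ)}

/-- In degree of a minimal generator, multiplication by `r` is multiplication by its constant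
term. -/
theorem coeff_mul_of_mem_monomialIdeal (hM : IsAntichain (· ≤ ·) M) {s : σ →₀ ℕ} (hs : s ∈ M)
    (r : MvPolynomial σ k) {g : MvPolynomial σ k} (hg : g ∈ monomialIdeal k M) :
    coeff s (r * g) = coeff 0 r * coeff s g := by
  classical
  rw [coeff_mul, Finset.sum_eq_single (0, s)]
  · rintro ⟨a, b⟩ hab hne
    rw [Finset.HasAntidiagonal.mem_antidiagonal] at hab
    by_contra h
    obtain ⟨t, ht, htb⟩ := mem_ideal_span_monomial_image.1 hg b
      (mem_support_iff.2 (right_ne_zero_of_mul h))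
    have hbs : b ≤ s := le_of_add_le_right hab.le
    have hts : t = s := hM.eq ht hs (htb.trans hbs)
    have hb : b = s := le_antisymm hbs (hts ▸ htb)
    subst hb
    exact hne (Prod.ext (by simpa using hab) rfl)
  · intro h
    exact absurd (Finset.HasAntidiagonal.mem_antidiagonal.2 (zero_add s)) h

theorem mu_monomialIdeal (hfin : M.Finite) (hM : IsAntichain (· ≤ ·) M) :
    mu (monomialIdeal k M) = M.ncard := by
  classical
  have hinj : Function.Injective fun s : σ →₀ ℕ => monomial s (1 : k) :=
    monomial_left_injective one_ne_zero
  refine le_antisymm ?_ ?_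
  · rw [← Set.ncard_image_of_injective M hinj]
    exact Submodule.spanFinrank_span_le_ncard_of_finite (hfin.image _)
  · have := hfin.fintype
    obtain ⟨T, hT, hspan⟩ := (Submodule.fg_span (R := MvPolynomial σ k)
      (hfin.image fun s => monomial s (1 : k))).exists_span_finset_card_eq_spanFinrank
    -- Reading off the coefficients at `M` plays the role of `I → I / 𝔪 I`: on the ideal, `R` acts
    -- through constant terms. The images of any generating set `T` therefore span `k^M`, so `|T| ≥
    -- |M|`.
    let φ : MvPolynomial σ k →ₗ[k] (M → k) := LinearMap.pi fun s => lcoeff k (s : σ →₀ ℕ)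
    have hφ : ∀ f s, φ f s = coeff (s : σ →₀ ℕ) f := fun _ _ => rfl
    have hmem : ∀ f ∈ Submodule.span (MvPolynomial σ k) (T : Set (MvPolynomial σ k)),
        φ f ∈ Submodule.span k ((T.image φ : Finset (M → k)) : Set (M → k)) := by
      intro f hf
      induction hf using Submodule.span_induction with
      | mem f hf => exact Submodule.subset_span (Finset.mem_coe.2 (Finset.mem_image_of_mem _ hf))
      | zero => rw [map_zero]; exact Submodule.zero_mem _
      | add f g _ _ hf hg => rw [map_add]; exact Submodule.add_mem _ hf hg
      | smul r f hf hf' =>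
        have : φ (r • f) = coeff 0 r • φ f := by
          ext s
          rw [hspan] at hf
          rw [Pi.smul_apply, hφ, hφ, smul_eq_mul, smul_eq_mul,
            coeff_mul_of_mem_monomialIdeal hM s.2 r hf]
        rw [this]
        exact Submodule.smul_mem _ _ hf'
    have htop : Submodule.span k ((T.image φ : Finset (M → k)) : Set (M → k)) = ⊤ := by
      rw [eq_top_iff, ← (Pi.basisFun k M).span_eq, Submodule.span_le]
      rintro _ ⟨s, rfl⟩
      have h := hmem (monomial s 1) (by rw [hspan]; exact Submodule.subset_span ⟨s, s.2, rfl⟩)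
      have hs : φ (monomial s 1) = Pi.basisFun k M s := by
        ext t
        rw [hφ, coeff_monomial, Pi.basisFun_apply, Pi.single_apply]
        simp [Subtype.ext_iff, eq_comm]
      rwa [← hs]
    have hle := finrank_span_finset_le_card (R := k) (T.image φ)
    rw [Set.finrank, htop, finrank_top, Module.finrank_fintype_fun_eq_card] at hle
    rw [← Nat.card_coe_set_eq, Nat.card_eq_fintype_card]
    exact (hle.trans Finset.card_image_le).trans hT.le

theorem monomialIdeal_sq (M : Set (σ →₀ ℕ)) :
    monomialIdeal k M ^ 2 = monomialIdeal k (M + M) := by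
  rw [sq, monomialIdeal, Ideal.span_mul_span', monomialIdeal]
  congr 1
  ext f
  simp only [Set.mem_mul, Set.mem_add, Set.mem_image]
  constructor
  · rintro ⟨_, ⟨s, hs, rfl⟩, _, ⟨t, ht, rfl⟩, rfl⟩
    exact ⟨s + t, ⟨s, hs, t, ht, rfl⟩, by simp [monomial_mul]⟩
  · rintro ⟨_, ⟨s, hs, t, ht, rfl⟩, rfl⟩
    exact ⟨_, ⟨s, hs, rfl⟩, _, ⟨t, ht, rfl⟩, by simp [monomial_mul]⟩

theorem eq_of_le_of_weight_eq (hα : ∀ i, 1 ≤ α i) {s t : σ →₀ ℕ} (h : s ≤ t)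
    (hw : Finsupp.weight α s = Finsupp.weight α t) : s = t := by
  obtain ⟨u, rfl⟩ := exists_add_of_le h
  rw [map_add] at hw
  have hu : u = 0 := by
    ext i
    by_contra hi
    have := Finsupp.le_weight_of_ne_zero' α hi
    have := hα i
    omega
  rw [hu, add_zero]

theorem isAntichain_of_weight_eq (hα : ∀ i, 1 ≤ α i) (hM : ∀ s ∈ M, Finsupp.weight α s = d) :
    IsAntichain (· ≤ ·) M := fun s hs t ht hne hle =>
  hne (eq_of_le_of_weight_eq hα hle ((hM s hs).trans (hM t ht).symm))

theorem finite_of_weight_eq [Finite σ] (hα : ∀ i, 1 ≤ α i)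
    (hM : ∀ s ∈ M, Finsupp.weight α s = d) : M.Finite :=
  (Finsupp.finite_of_nat_weight_eq α (fun i => Nat.one_le_iff_ne_zero.1 (hα i)) d).subset hM

theorem weight_eq_of_mem_add (hM : ∀ s ∈ M, Finsupp.weight α s = d) :
    ∀ s ∈ M + M, Finsupp.weight α s = 2 * d := by
  rintro _ ⟨s, hs, t, ht, rfl⟩
  rw [map_add, hM s hs, hM t ht, two_mul]

theorem minimalExponents_monomialIdeal (hM : IsAntichain (· ≤ ·) M) :
    minimalExponents (monomialIdeal k M) = M := by
  ext s
  simp only [minimalExponents, Set.mem_ofPred_eq, monomial_mem_monomialIdeal_iff]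
  constructor
  · intro h
    obtain ⟨t, ht, hts⟩ := h.prop
    rwa [← hts.antisymm (h.le_of_le ⟨t, ht, le_rfl⟩ hts)]
  · refine fun hs => ⟨⟨s, hs, le_rfl⟩, ?_⟩
    rintro t ⟨u, hu, hut⟩ hts
    rw [← hM.eq hu hs (hut.trans hts)]
    exact hut

theorem isQuasiEquigenerated_monomialIdeal (hα : ∀ i, 1 ≤ α i)
    (hM : ∀ s ∈ M, Finsupp.weight α s = d) : IsQuasiEquigenerated (monomialIdeal k M) :=
  ⟨⟨M, rfl⟩, α, hα, d, by
    rwa [minimalExponents_monomialIdeal (isAntichain_of_weight_eq hα hM)]⟩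

theorem exists_mem_minimalExponents_le [Finite σ] {I : Ideal (MvPolynomial σ k)} {t : σ →₀ ℕ}
    (ht : monomial t (1 : k) ∈ I) : ∃ s ∈ minimalExponents I, s ≤ t := by
  obtain ⟨s, hst, hs⟩ := exists_minimal_le_of_wellFoundedLT
    (fun t => monomial t (1 : k) ∈ I) t ht
  exact ⟨s, hs, hst⟩

theorem IsMonomialIdeal.eq_monomialIdeal_minimalExponents [Finite σ]
    {I : Ideal (MvPolynomial σ k)} (hI : IsMonomialIdeal I) :
    I = monomialIdeal k (minimalExponents I) := by
  refine le_antisymm ?_ (Ideal.span_le.2 ?_)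
  · obtain ⟨S, hS⟩ := hI
    conv_lhs => rw [hS]
    refine Ideal.span_le.2 ?_
    rintro _ ⟨s, hs, rfl⟩
    refine monomial_mem_monomialIdeal_iff.2 (exists_mem_minimalExponents_le ?_)
    rw [hS]
    exact Ideal.subset_span ⟨s, hs, rfl⟩
  · rintro _ ⟨s, hs, rfl⟩
    exact Minimal.prop (P := fun t => monomial t (1 : k) ∈ I) hs

theorem exponentRank_le_ncard (hfin : M.Finite) : exponentRank M ≤ M.ncard := by
  have := hfin.fintype
  rw [exponentRank, Set.image_eq_range, ← Nat.card_coe_set_eq, Nat.card_eq_fintype_card]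
  exact finrank_range_le_card _

variable [Finite σ]

theorem analyticSpread_monomialIdeal (hα : ∀ i, 1 ≤ α i)
    (hM : ∀ s ∈ M, Finsupp.weight α s = d) :
    analyticSpread (monomialIdeal k M) = (exponentRank M : ℕ) := by
  obtain ⟨e⟩ := nonempty_toricAlgebra_algEquiv_fiberCone (k := k) hα hM
  rw [analyticSpread, ← ringKrullDim_eq_of_ringEquiv e.toRingEquiv,
    ringKrullDim_toricAlgebra (finite_of_weight_eq hα hM)]

theorem isFreiman_monomialIdeal_iff (hα : ∀ i, 1 ≤ α i)
    (hM : ∀ s ∈ M, Finsupp.weight α s = d) :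
    IsFreiman (monomialIdeal k M) ↔
      (M + M).ncard + (exponentRank M).choose 2 = exponentRank M * M.ncard := by
  rw [IsFreiman, and_iff_right (isQuasiEquigenerated_monomialIdeal hα hM), monomialIdeal_sq,
    mu_monomialIdeal (finite_of_weight_eq hα hM) (isAntichain_of_weight_eq hα hM),
    mu_monomialIdeal (finite_of_weight_eq hα (weight_eq_of_mem_add hM))
      (isAntichain_of_weight_eq hα (weight_eq_of_mem_add hM)),
    analyticSpread_monomialIdeal hα hM]
  zify
  constructor
  · rintro ⟨l, hl, h⟩
    have : exponentRank M = l := by exact_mod_cast hl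
    rw [this, h]
    ring
  · intro h
    exact ⟨_, rfl, by rw [← h]; ring⟩

theorem isLinearType_monomialIdeal_iff (hα : ∀ i, 1 ≤ α i)
    (hM : ∀ s ∈ M, Finsupp.weight α s = d) :
    IsLinearType (monomialIdeal k M) ↔ exponentRank M = M.ncard := by
  have hfin := finite_of_weight_eq hα hM
  have hmu := mu_monomialIdeal (k := k) hfin (isAntichain_of_weight_eq hα hM)
  have := hfin.fintype
  have hcard : M.ncard = Fintype.card M := by
    rw [← Nat.card_coe_set_eq, Nat.card_eq_fintype_card]
  constructor
  · rintro ⟨e⟩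
    have h := analyticSpread_monomialIdeal (k := k) hα hM
    rw [analyticSpread, ringKrullDim_eq_of_ringEquiv e.toRingEquiv,
      MvPolynomial.ringKrullDim_of_isNoetherianRing, ringKrullDim_eq_zero_of_field, zero_add,
      Nat.card_eq_fintype_card, Fintype.card_fin, hmu] at h
    exact_mod_cast h.symm
  · intro h
    have hli : LinearIndependent ℚ fun s : M => expVector ((s : σ →₀ ℕ), 1) := by
      rw [linearIndependent_iff_card_eq_finrank_span, ← hcard, ← h, exponentRank,
        Set.image_eq_range]
      rfl
    have hai := (algebraicIndependent_toricGenerator_iff (k := k) M id).2 hli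
    obtain ⟨e⟩ := nonempty_toricAlgebra_algEquiv_fiberCone (k := k) hα hM
    have e₁ := hai.aevalEquiv
    have e₂ := ((Subalgebra.equivOfEq _ _ (adjoin_toricGenerator (k := k) M)).trans
      Subalgebra.topEquiv)
    have e₃ : M ≃ Fin (mu (monomialIdeal k M)) :=
      (Fintype.equivFin M).trans (finCongr (by rw [hmu, hcard]))
    exact ⟨(((renameEquiv k e₃.symm).trans e₁).trans (e₂.trans e)).symm⟩

theorem exponentRank_mul_ncard_le (hfin : M.Finite) :
    exponentRank M * M.ncard ≤ (M + M).ncard + (exponentRank M).choose 2 := by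
  have := Fintype.ofFinite σ
  have hinj : Function.Injective fun s : σ →₀ ℕ => expVector (s, 1) := fun s t h =>
    congrArg Prod.fst (expVector_injective h)
  -- Height `2`, because `(s, 1) + (t, 1) = (s + t, 2)`.
  have hinj' : Function.Injective fun s : σ →₀ ℕ => expVector (s, 2) := fun s t h =>
    congrArg Prod.fst (expVector_injective h)
  have h := freiman_inequality _ (hfin.image fun s => expVector (s, 1))
  rw [Set.ncard_image_of_injective _ hinj] at h
  refine h.trans_eq ?_
  rw [← Set.ncard_image_of_injective (M + M) hinj', exponentRank]
  congr 2
  ext v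
  refine Iff.symm ⟨?_, ?_⟩
  · rintro ⟨_, ⟨s, hs, t, ht, rfl⟩, rfl⟩
    exact ⟨_, ⟨s, hs, rfl⟩, _, ⟨t, ht, rfl⟩, by simp only; rw [← map_add]; rfl⟩
  · rintro ⟨_, ⟨s, hs, rfl⟩, _, ⟨t, ht, rfl⟩, rfl⟩
    exact ⟨s + t, ⟨s, hs, t, ht, rfl⟩, by simp only; rw [← map_add]; rfl⟩

end MonomialIdeal

/-! ### Cover ideals of joins -/

section Join

variable {V W : Type*} {k : Type*} [Field k]

/-- The exponent vector with all entries `1`. -/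
noncomputable def onesVector (V : Type*) [Finite V] : V →₀ ℕ :=
  Finsupp.equivFunOnFinite.symm fun _ => 1

@[simp]
theorem onesVector_apply [Finite V] (v : V) : onesVector V v = 1 := rfl

/-- Exponent vectors on a disjoint union from pairs of exponent vectors. -/
noncomputable def glue : (V →₀ ℕ) × (W →₀ ℕ) ≃+ (V ⊕ W →₀ ℕ) :=
  Finsupp.sumFinsuppAddEquivProdFinsupp.symm

@[simp]
theorem glue_inl (p : (V →₀ ℕ) × (W →₀ ℕ)) (v : V) : glue p (Sum.inl v) = p.1 v := by
  simp [glue]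

@[simp]
theorem glue_inr (p : (V →₀ ℕ) × (W →₀ ℕ)) (w : W) : glue p (Sum.inr w) = p.2 w := by
  simp [glue]

/-- The exponents of the generators of the cover ideal of a join, from those of the cover ideals
of the two graphs. -/
def joinExponents [Finite V] [Finite W] (M : Set (V →₀ ℕ)) (N : Set (W →₀ ℕ)) :
    Set (V ⊕ W →₀ ℕ) :=
  glue '' (M ×ˢ {onesVector W} ∪ {onesVector V} ×ˢ N)

theorem mem_coverIdeal_iff {G : SimpleGraph V} {f : MvPolynomial V k} :
    f ∈ coverIdeal k G ↔ ∀ m ∈ f.support, ∀ u v, G.Adj u v → m u ≠ 0 ∨ m v ≠ 0 := by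
  simp only [coverIdeal, Submodule.mem_iInf]
  have key : ∀ u v : V, f ∈ Ideal.span {(X u : MvPolynomial V k), X v} ↔
      ∀ m ∈ f.support, m u ≠ 0 ∨ m v ≠ 0 := by
    intro u v
    rw [← Set.image_pair, mem_ideal_span_X_image]
    simp
  simp only [key]
  exact ⟨fun h m hm u v huv => h u v huv m hm, fun h u v huv m hm => h m hm u v huv⟩

theorem monomial_mem_coverIdeal_iff {G : SimpleGraph V} {m : V →₀ ℕ} :
    monomial m (1 : k) ∈ coverIdeal k G ↔ ∀ u v, G.Adj u v → m u ≠ 0 ∨ m v ≠ 0 := by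
  classical
  rw [mem_coverIdeal_iff, support_monomial, if_neg one_ne_zero]
  simp

/-- Extend a vector on `V` by its homogenizing coordinate on `W`. -/
def extendRight (V W : Type*) : ((V → ℚ) × ℚ) →ₗ[ℚ] (V ⊕ W → ℚ) × ℚ where
  toFun p := (Sum.elim p.1 fun _ => p.2, p.2)
  map_add' p q := Prod.ext (funext fun i => by cases i <;> rfl) rfl
  map_smul' c p := Prod.ext (funext fun i => by cases i <;> rfl) rfl

/-- Extend a vector on `W` by its homogenizing coordinate on `V`. -/
def extendLeft (V W : Type*) : ((W → ℚ) × ℚ) →ₗ[ℚ] (V ⊕ W → ℚ) × ℚ where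
  toFun p := (Sum.elim (fun _ => p.2) p.1, p.2)
  map_add' p q := Prod.ext (funext fun i => by cases i <;> rfl) rfl
  map_smul' c p := Prod.ext (funext fun i => by cases i <;> rfl) rfl

theorem extendRight_injective : Function.Injective (extendRight V W) := by
  intro p q h
  have h2 : p.2 = q.2 := (Prod.ext_iff.1 h).2
  refine Prod.ext (funext fun v => ?_) h2
  exact congrFun (congrArg Prod.fst h) (Sum.inl v)

theorem extendLeft_injective : Function.Injective (extendLeft V W) := by
  intro p q h
  have h2 : p.2 = q.2 := (Prod.ext_iff.1 h).2
  refine Prod.ext (funext fun v => ?_) h2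
  exact congrFun (congrArg Prod.fst h) (Sum.inr v)

theorem expVector_glue_onesVector_right [Finite W] (s : V →₀ ℕ) :
    expVector (glue (s, onesVector W), 1) = extendRight V W (expVector (s, 1)) := by
  refine Prod.ext (funext fun i => ?_) rfl
  rcases i with v | w <;> simp [expVector, extendRight]

theorem expVector_glue_onesVector_left [Finite V] (t : W →₀ ℕ) :
    expVector (glue (onesVector V, t), 1) = extendLeft V W (expVector (t, 1)) := by
  refine Prod.ext (funext fun i => ?_) rfl
  rcases i with v | w <;> simp [expVector, extendLeft]

variable [Finite V] [Finite W]

theorem coverIdeal_join (G : SimpleGraph V) (H : SimpleGraph W) :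
    coverIdeal k (join G H) = monomialIdeal k
      (joinExponents (minimalExponents (coverIdeal k G)) (minimalExponents (coverIdeal k H))) := by
  ext f
  rw [mem_coverIdeal_iff, mem_ideal_span_monomial_image]
  refine forall₂_congr fun m _ => ?_
  obtain ⟨⟨a, b⟩, rfl⟩ := glue.surjective m
  have hle : ∀ {p : (V →₀ ℕ) × (W →₀ ℕ)}, p.1 ≤ a → p.2 ≤ b → glue p ≤ glue (a, b) := by
    intro p h1 h2 i
    rcases i with v | w
    · simpa using h1 v
    · simpa using h2 w
  constructor
  · intro h
    have ha : monomial a (1 : k) ∈ coverIdeal k G := by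
      rw [monomial_mem_coverIdeal_iff]
      intro u v huv
      simpa using h (Sum.inl u) (Sum.inl v) (by simpa [join] using huv)
    have hb : monomial b (1 : k) ∈ coverIdeal k H := by
      rw [monomial_mem_coverIdeal_iff]
      intro u v huv
      simpa using h (Sum.inr u) (Sum.inr v) (by simpa [join] using huv)
    -- If some vertex of `V` is left out, its edges to all of `W` force every vertex of `W` into the
    -- cover.
    by_cases hV : onesVector V ≤ a
    · obtain ⟨t, ht, htb⟩ := exists_mem_minimalExponents_le hb
      exact ⟨_, ⟨(onesVector V, t), Or.inr ⟨rfl, ht⟩, rfl⟩, hle hV htb⟩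
    · have hW : onesVector W ≤ b := by
        rw [Finsupp.le_def, not_forall] at hV
        obtain ⟨v, hv⟩ := hV
        intro w
        have := h (Sum.inl v) (Sum.inr w) (by simp [join])
        simp only [glue_inl, glue_inr, onesVector_apply] at this hv ⊢
        omega
      obtain ⟨s, hs, hsa⟩ := exists_mem_minimalExponents_le ha
      exact ⟨_, ⟨(s, onesVector W), Or.inl ⟨hs, rfl⟩, rfl⟩, hle hsa hW⟩
  · rintro ⟨_, ⟨⟨s, t⟩, hst, rfl⟩, hm⟩ i j hij
    have h1 : ∀ v, s v ≤ a v := fun v => by simpa using hm (Sum.inl v)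
    have h2 : ∀ w, t w ≤ b w := fun w => by simpa using hm (Sum.inr w)
    have hs : ∀ u v, G.Adj u v → a u ≠ 0 ∨ a v ≠ 0 := by
      intro u v huv
      have : s u ≠ 0 ∨ s v ≠ 0 := by
        rcases hst with ⟨hs, -⟩ | ⟨hs, -⟩
        · exact monomial_mem_coverIdeal_iff.1
            (Minimal.prop (P := fun t => monomial t (1 : k) ∈ coverIdeal k G) hs) u v huv
        · left
          simp [show s = onesVector V from hs]
      have := h1 u
      have := h1 v
      omega
    have ht : ∀ u v, H.Adj u v → b u ≠ 0 ∨ b v ≠ 0 := by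
      intro u v huv
      have : t u ≠ 0 ∨ t v ≠ 0 := by
        rcases hst with ⟨-, ht⟩ | ⟨-, ht⟩
        · left
          simp [show t = onesVector W from ht]
        · exact monomial_mem_coverIdeal_iff.1
            (Minimal.prop (P := fun t => monomial t (1 : k) ∈ coverIdeal k H) ht) u v huv
      have := h2 u
      have := h2 v
      omega
    have hVW : ∀ v w, a v ≠ 0 ∨ b w ≠ 0 := by
      intro v w
      have := h1 v
      have := h2 w
      rcases hst with ⟨-, ht⟩ | ⟨hs, -⟩
      · have : t w = 1 := by simp [show t = onesVector W from ht]
        omega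
      · have : s v = 1 := by simp [show s = onesVector V from hs]
        omega
    rcases i with u | u <;> rcases j with v | v <;> simp only [glue_inl, glue_inr]
    · exact hs u v (by simpa [join] using hij)
    · exact hVW u v
    · exact (hVW v u).symm
    · exact ht u v (by simpa [join] using hij)

/-- The all-ones vector is a cover that is not minimal, so its weight exceeds that of the minimal
generators. -/
theorem lt_weight_onesVector [Nonempty V] (G : SimpleGraph V) {α : V → ℕ} {d : ℕ}
    (hα : ∀ i, 1 ≤ α i)
    (hM : ∀ s ∈ minimalExponents (coverIdeal k G), Finsupp.weight α s = d) :
    d < Finsupp.weight α (onesVector V) := by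
  classical
  obtain ⟨v₀⟩ := ‹Nonempty V›
  have hcov : monomial ((onesVector V).erase v₀) (1 : k) ∈ coverIdeal k G := by
    rw [monomial_mem_coverIdeal_iff]
    intro u v huv
    by_cases hu : u = v₀
    · right
      have : v ≠ v₀ := fun hv => huv.ne (hu.trans hv.symm)
      simp [Finsupp.erase_ne this]
    · left
      simp [Finsupp.erase_ne hu]
  obtain ⟨s, hs, hle⟩ := exists_mem_minimalExponents_le hcov
  rw [← hM s hs]
  refine (weight_le_weight_of_le α hle).trans_lt ?_
  conv_rhs => rw [← Finsupp.single_add_erase v₀ (onesVector V)]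
  rw [map_add, Finsupp.weight_single]
  have := hα v₀
  simp only [onesVector_apply, one_smul]
  omega

theorem weight_glue (α : V → ℕ) (β : W → ℕ) (a b : ℕ) (p : (V →₀ ℕ) × (W →₀ ℕ)) :
    Finsupp.weight (Sum.elim (a • α) (b • β)) (glue p) =
      a * Finsupp.weight α p.1 + b * Finsupp.weight β p.2 := by
  have := Fintype.ofFinite V
  have := Fintype.ofFinite W
  simp only [Finsupp.weight_eq_sum, Fintype.sum_sum_type, glue_inl, glue_inr, Sum.elim_inl,
    Sum.elim_inr, Finset.mul_sum, Pi.smul_apply, smul_eq_mul]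
  congr 1 <;> exact Finset.sum_congr rfl fun _ _ => by ring

/-- Scaling each weight by the other side's gap balances the two kinds of generators: `b c + a (d +
b) = b (c + a) + a d`. -/
theorem weight_eq_of_mem_joinExponents {M : Set (V →₀ ℕ)} {N : Set (W →₀ ℕ)} {α : V → ℕ}
    {β : W → ℕ} {c d a b : ℕ} (hM : ∀ s ∈ M, Finsupp.weight α s = c)
    (hN : ∀ t ∈ N, Finsupp.weight β t = d) (ha : Finsupp.weight α (onesVector V) = c + a)
    (hb : Finsupp.weight β (onesVector W) = d + b) :
    ∀ s ∈ joinExponents M N,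
      Finsupp.weight (Sum.elim (b • α) (a • β)) s = b * c + a * d + a * b := by
  rintro _ ⟨⟨s, t⟩, hst, rfl⟩
  rw [weight_glue]
  rcases hst with ⟨hs, ht⟩ | ⟨hs, ht⟩
  · rw [hM s hs, show t = onesVector W from ht, hb]
    ring
  · rw [hN t ht, show s = onesVector V from hs, ha]
    ring

/-- The sumset has three kinds of elements, told apart by the value of `f` on the first coordinate:
`2 d`, `d + f u` or `2 f u`. A mixed sum `(s + u, v + t)` determines `s` and `t` by cancellation. -/
theorem ncard_prod_union_add_self {P Q : Type*} [AddCommMonoid P] [IsCancelAdd P]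
    [AddCommMonoid Q] [IsCancelAdd Q] (f : P →+ ℕ) {M : Set P} {N : Set Q} {u : P} {v : Q}
    {d : ℕ} (hM : ∀ s ∈ M, f s = d) (hu : d < f u) (hMf : M.Finite) (hNf : N.Finite) :
    ((M ×ˢ {v} ∪ {u} ×ˢ N) + (M ×ˢ {v} ∪ {u} ×ˢ N)).ncard =
      (M + M).ncard + M.ncard * N.ncard + (N + N).ncard := by
  have hsum : (M ×ˢ {v} ∪ {u} ×ˢ N) + (M ×ˢ {v} ∪ {u} ×ˢ N) =
      ((M + M) ×ˢ {v + v} ∪ (M + {u}) ×ˢ ({v} + N)) ∪ {u + u} ×ˢ (N + N) := by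
    rw [Set.union_add, Set.add_union, Set.add_union, Set.prod_add_prod_comm,
      Set.prod_add_prod_comm, Set.prod_add_prod_comm, Set.prod_add_prod_comm,
      Set.singleton_add_singleton, Set.singleton_add_singleton, add_comm {u} M, add_comm N {v}]
    ext
    simp only [Set.mem_union]
    tauto
  have h1 : ∀ p ∈ (M + M) ×ˢ {v + v}, f p.1 = d + d := by
    rintro ⟨_, _⟩ ⟨⟨s, hs, t, ht, rfl⟩, -⟩
    simp only [map_add, hM s hs, hM t ht]
  have h2 : ∀ p ∈ (M + {u}) ×ˢ ({v} + N), f p.1 = d + f u := by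
    rintro ⟨_, _⟩ ⟨⟨s, hs, t, ht, rfl⟩, -⟩
    simp only [map_add, hM s hs, show t = u from ht]
  have h3 : ∀ p ∈ ({u + u} : Set P) ×ˢ (N + N), f p.1 = f u + f u := by
    rintro ⟨s, _⟩ ⟨hs, -⟩
    simp only [show s = u + u from hs, map_add]
  have f1 : ((M + M) ×ˢ {v + v}).Finite := (hMf.add hMf).prod (Set.finite_singleton _)
  have f2 : ((M + {u}) ×ˢ ({v} + N)).Finite :=
    (hMf.add (Set.finite_singleton _)).prod ((Set.finite_singleton _).add hNf)
  have f3 : (({u + u} : Set P) ×ˢ (N + N)).Finite := (Set.finite_singleton _).prod (hNf.add hNf)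
  have d12 : Disjoint ((M + M) ×ˢ {v + v}) ((M + {u}) ×ˢ ({v} + N)) := by
    rw [Set.disjoint_left]
    intro p hp hp'
    have := h1 p hp
    have := h2 p hp'
    omega
  have d3 : Disjoint ((M + M) ×ˢ {v + v} ∪ (M + {u}) ×ˢ ({v} + N)) ({u + u} ×ˢ (N + N)) := by
    rw [Set.disjoint_left]
    rintro p (hp | hp) hp'
    · have := h1 p hp
      have := h3 p hp'
      omega
    · have := h2 p hp
      have := h3 p hp'
      omega
  rw [hsum, Set.ncard_union_eq d3 (f1.union f2) f3, Set.ncard_union_eq d12 f1 f2, Set.ncard_prod,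
    Set.ncard_prod, Set.ncard_prod, Set.ncard_singleton, Set.ncard_singleton, Set.add_singleton,
    Set.singleton_add, Set.ncard_image_of_injective _ (add_left_injective u),
    Set.ncard_image_of_injective _ (add_right_injective v), mul_one, one_mul]

theorem ncard_joinExponents_add_self {M : Set (V →₀ ℕ)} {N : Set (W →₀ ℕ)} {α : V → ℕ} {d : ℕ}
    (hM : ∀ s ∈ M, Finsupp.weight α s = d) (hd : d < Finsupp.weight α (onesVector V))
    (hMf : M.Finite) (hNf : N.Finite) :
    (joinExponents M N + joinExponents M N).ncard =
      (M + M).ncard + M.ncard * N.ncard + (N + N).ncard := by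
  rw [joinExponents, ← Set.image_add, Set.ncard_image_of_injective _ glue.injective,
    ncard_prod_union_add_self (Finsupp.weight α) hM hd hMf hNf]

theorem ncard_joinExponents {M : Set (V →₀ ℕ)} {N : Set (W →₀ ℕ)} {α : V → ℕ} {d : ℕ}
    (hM : ∀ s ∈ M, Finsupp.weight α s = d) (hd : d < Finsupp.weight α (onesVector V))
    (hMf : M.Finite) (hNf : N.Finite) :
    (joinExponents M N).ncard = M.ncard + N.ncard := by
  have hdisj : Disjoint (M ×ˢ {onesVector W}) ({onesVector V} ×ˢ N) := by
    rw [Set.disjoint_left]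
    rintro ⟨s, t⟩ ⟨hs, -⟩ ⟨hs', -⟩
    have := hM s hs
    rw [show s = onesVector V from hs'] at this
    omega
  rw [joinExponents, Set.ncard_image_of_injective _ glue.injective,
    Set.ncard_union_eq hdisj (hMf.prod (Set.finite_singleton _))
      ((Set.finite_singleton _).prod hNf),
    Set.ncard_prod, Set.ncard_prod, Set.ncard_singleton, Set.ncard_singleton, mul_one, one_mul]

/-- The two spans meet trivially: a common vector is constant on `V`, equal to its height. The
functional `L` (weight minus `d` times height) kills the span of `M`, but equals the height times a
positive number on such a vector. -/
theorem exponentRank_joinExponents {M : Set (V →₀ ℕ)} {N : Set (W →₀ ℕ)} {α : V → ℕ} {d : ℕ}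
    (hM : ∀ s ∈ M, Finsupp.weight α s = d) (hd : d < Finsupp.weight α (onesVector V)) :
    exponentRank (joinExponents M N) = exponentRank M + exponentRank N := by
  have := Fintype.ofFinite V
  have := Fintype.ofFinite W
  set A := Submodule.span ℚ ((fun s : V →₀ ℕ => expVector (s, 1)) '' M) with hA
  set B := Submodule.span ℚ ((fun s : W →₀ ℕ => expVector (s, 1)) '' N) with hB
  have hspan : Submodule.span ℚ ((fun s => expVector (s, 1)) '' joinExponents M N) =
      A.map (extendRight V W) ⊔ B.map (extendLeft V W) := by
    rw [hA, hB, ← Submodule.span_image, ← Submodule.span_image, ← Submodule.span_union,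
      joinExponents, Set.image_union, Set.image_union]
    congr 2
    · rw [Set.prod_singleton, Set.image_image, Set.image_image, Set.image_image]
      exact Set.image_congr fun s _ => expVector_glue_onesVector_right s
    · rw [Set.singleton_prod, Set.image_image, Set.image_image, Set.image_image]
      exact Set.image_congr fun s _ => expVector_glue_onesVector_left s
  let L : ((V → ℚ) × ℚ) →ₗ[ℚ] ℚ :=
    (∑ v, (α v : ℚ) • LinearMap.proj v) ∘ₗ LinearMap.fst ℚ _ _ - (d : ℚ) • LinearMap.snd ℚ _ _
  have hL : ∀ p, L p = ∑ v, (α v : ℚ) * p.1 v - d * p.2 := by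
    intro p
    simp [L]
  have hLA : A ≤ LinearMap.ker L := by
    rw [hA, Submodule.span_le]
    rintro _ ⟨s, hs, rfl⟩
    change L _ = 0
    have := hM s hs
    rw [Finsupp.weight_eq_sum] at this
    rw [hL, ← this]
    simp [expVector, mul_comm]
  have hinf : A.map (extendRight V W) ⊓ B.map (extendLeft V W) = ⊥ := by
    rw [eq_bot_iff]
    rintro _ ⟨⟨p, hp, rfl⟩, q, -, hpq⟩
    have h2 : q.2 = p.2 := congrArg Prod.snd hpq
    have h1 : ∀ v, p.1 v = p.2 := fun v =>
      (congrFun (congrArg Prod.fst hpq) (Sum.inl v)).symm.trans h2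
    have h0 : L p = 0 := hLA hp
    rw [hL] at h0
    simp only [h1] at h0
    have hw : ((Finsupp.weight α (onesVector V) : ℕ) : ℚ) = ∑ v, (α v : ℚ) := by
      simp [Finsupp.weight_eq_sum]
    rw [← Finset.sum_mul, ← hw, ← sub_mul] at h0
    have hd' : (d : ℚ) < (Finsupp.weight α (onesVector V) : ℕ) := by exact_mod_cast hd
    have hp2 : p.2 = 0 := (mul_eq_zero.1 h0).resolve_left (sub_pos.2 hd').ne'
    have hp0 : p = 0 := Prod.ext (funext fun v => by rw [h1, hp2]; rfl) hp2
    rw [hp0, map_zero]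
    exact Submodule.zero_mem _
  have h := Submodule.finrank_sup_add_finrank_inf_eq (A.map (extendRight V W))
    (B.map (extendLeft V W))
  rw [hinf, finrank_bot, add_zero, ← hspan,
    ← (Submodule.equivMapOfInjective _ extendRight_injective A).finrank_eq,
    ← (Submodule.equivMapOfInjective _ extendLeft_injective B).finrank_eq] at h
  exact h

theorem choose_two_add (a b : ℕ) : (a + b).choose 2 = a.choose 2 + b.choose 2 + a * b := by
  induction b with
  | zero => simp
  | succ b ih =>
    rw [← add_assoc, Nat.choose_succ_succ' _ 1, Nat.choose_succ_succ' b 1, ih,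
      Nat.choose_one_right, Nat.choose_one_right]
    ring

theorem isFreiman_joinExponents_iff {M : Set (V →₀ ℕ)}
    {N : Set (W →₀ ℕ)} {α : V → ℕ} {β : W → ℕ} {c d : ℕ}
    (hα : ∀ i, 1 ≤ α i) (hβ : ∀ i, 1 ≤ β i)
    (hM : ∀ s ∈ M, Finsupp.weight α s = c) (hN : ∀ t ∈ N, Finsupp.weight β t = d)
    (hc : c < Finsupp.weight α (onesVector V)) (hd : d < Finsupp.weight β (onesVector W)) :
    IsFreiman (monomialIdeal k (joinExponents M N)) ↔
      (IsFreiman (monomialIdeal k M) ∧ IsFreiman (monomialIdeal k N)) ∧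
        (IsLinearType (monomialIdeal k M) ∨ IsLinearType (monomialIdeal k N)) := by
  obtain ⟨a, ha⟩ := exists_add_of_le hc.le
  obtain ⟨b, hb⟩ := exists_add_of_le hd.le
  have ha0 : 1 ≤ a := by omega
  have hb0 : 1 ≤ b := by omega
  have hαβ : ∀ i, 1 ≤ Sum.elim (b • α) (a • β) i := by
    rintro (v | w)
    · exact Nat.mul_pos hb0 (hα v)
    · exact Nat.mul_pos ha0 (hβ w)
  have hMf := finite_of_weight_eq hα hM
  have hNf := finite_of_weight_eq hβ hN
  rw [isFreiman_monomialIdeal_iff hαβ (weight_eq_of_mem_joinExponents hM hN ha hb),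
    isFreiman_monomialIdeal_iff hα hM, isFreiman_monomialIdeal_iff hβ hN,
    isLinearType_monomialIdeal_iff hα hM, isLinearType_monomialIdeal_iff hβ hN,
    ncard_joinExponents_add_self hM hc hMf hNf, ncard_joinExponents hM hc hMf hNf,
    exponentRank_joinExponents hM hc, choose_two_add]
  have h1 := exponentRank_mul_ncard_le hMf
  have h2 := exponentRank_mul_ncard_le hNf
  -- `x` and `y` are the Freiman defects, `p` and `q` the excesses of cardinality over rank; the
  -- defect of the join is `x + y + p * q`.
  obtain ⟨x, hx⟩ := exists_add_of_le h1
  obtain ⟨y, hy⟩ := exists_add_of_le h2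
  obtain ⟨p, hp⟩ := exists_add_of_le (exponentRank_le_ncard hMf)
  obtain ⟨q, hq⟩ := exists_add_of_le (exponentRank_le_ncard hNf)
  generalize (exponentRank M).choose 2 = C₁ at *
  generalize (exponentRank N).choose 2 = C₂ at *
  generalize (M + M).ncard = S₁ at *
  generalize (N + N).ncard = S₂ at *
  have key : S₁ + M.ncard * N.ncard + S₂ + (C₁ + C₂ + exponentRank M * exponentRank N) =
      (exponentRank M + exponentRank N) * (M.ncard + N.ncard) + (x + y + p * q) := by
    rw [hp, hq] at *
    linear_combination hx + hy
  rw [key, hx, hy, hp, hq]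
  simp only [Nat.add_eq_left, Nat.left_eq_add, Nat.add_eq_zero_iff, mul_eq_zero]

end Join

end FreimanJoin

theorem mainTheorem4 {k V₁ V₂ : Type*} [Field k] [Finite V₁] [Finite V₂]
    [Nonempty V₁] [Nonempty V₂] (G₁ : SimpleGraph V₁) (G₂ : SimpleGraph V₂)
    (h₁ : FreimanJoin.IsQuasiEquigenerated (FreimanJoin.coverIdeal k G₁))
    (h₂ : FreimanJoin.IsQuasiEquigenerated (FreimanJoin.coverIdeal k G₂)) :
    FreimanJoin.IsFreiman (FreimanJoin.coverIdeal k (FreimanJoin.join G₁ G₂)) ↔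
      (FreimanJoin.IsFreiman (FreimanJoin.coverIdeal k G₁) ∧
        FreimanJoin.IsFreiman (FreimanJoin.coverIdeal k G₂)) ∧
      (FreimanJoin.IsLinearType (FreimanJoin.coverIdeal k G₁) ∨
        FreimanJoin.IsLinearType (FreimanJoin.coverIdeal k G₂)) := by
  obtain ⟨hmon₁, α, hα, c, hM⟩ := h₁
  obtain ⟨hmon₂, β, hβ, d, hN⟩ := h₂
  have h := FreimanJoin.isFreiman_joinExponents_iff (k := k) hα hβ hM hN
    (FreimanJoin.lt_weight_onesVector G₁ hα hM) (FreimanJoin.lt_weight_onesVector G₂ hβ hN)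
  rwa [← FreimanJoin.coverIdeal_join, ← hmon₁.eq_monomialIdeal_minimalExponents,
    ← hmon₂.eq_monomialIdeal_minimalExponents] at h
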